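/- Throughout, $\mathrm{ZF}^-$ is the theory in the language $\{\in\}$ with the axioms of extensionality, foundation, pairing, union and infinity and the schemes of separation and collection (no power set axiom). A model $M$ of $\mathrm{ZF}^-$ is well-founded if its relation $\in^M$ is well-founded. "Definable" means first-order definable with parameters. An interpretation of a structure $N$ (in a language $L$) in a structure $M$ consists of a definable class $N^*\subseteq M^k$ for some finite $k$, a definable equivalence relation $\simeq$ on $N^*$, definable relations on $N^*$ for the relation symbols of $L$ and definable graphs for its function and constant symbols, all of which respect $\simeq$ (the graphs being graphs of functions modulo $\simeq$), and an isomorphism $j\colon N\to N^*/{\simeq}$ of $L$-structures. A map $f$ from $M$ to a quotient $N^*/{\simeq}$ defined in $M$ is definable in $M$ if the relation $\{(a,\bar x): \bar x\in N^*,\ f(a)=[\bar x]_\simeq\}$ is definable in $M$. A mutual interpretation of $M$ and $N$ is an interpretation $i\colon M\to M^*/{\simeq}$ of $M$ in $N$ together with an interpretation $j\colon N\to N^*/{\simeq}$ of $N$ in $M$. The composition $ji$ is regarded as the relation that holds between $a\in M$ and a tuple $(b_l)_l$ of elements of $N^*$ if and only if $i(a)$ has a representative $(u_l)_l\in M^*$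 such that $j(u_l)=[b_l]_\simeq$ for every $l$; $ij$ is defined likewise. The mutual interpretation is a bi-interpretation if $ji$ is definable in $M$ and $ij$ is definable in $N$. **Theorem.** Let $M$ be a well-founded model of $\mathrm{ZF}^-$. 1. Suppose that $M$ is interpreted in itself via an isomorphism $i\colon \langle M,\in^M\rangle\to\langle \bar M,\bar\in\rangle/{\simeq}$. Then $i$ is the only isomorphism of $\langle M,\in^M\rangle$ with $\langle \bar M,\bar\in\rangle/{\simeq}$, and $i$ is definable in $M$. Moreover, the relation of $\langle \bar M,\bar\in\rangle/{\simeq}$ is well-founded and $i^{-1}$ is its Mostowski collapse into $M$: it is the unique function $\pi\colon\bar M/{\simeq}\to M$ such that, for every $x\in\bar M/{\simeq}$, the elements of $\pi(x)$ in $M$ are exactly the $\pi(y)$ with $y\mathrel{\bar\in}x$. 2. For every mutual interpretation of $M$ with a structure $N$ in any first-order language, the composed isomorphism $ji$ of $M$ with its copy inside the copy of $N$ in $M$ is definable in $M$. 3. Every mutual interpretation of $M$ with a well-founded model $N$ of $\mathrm{ZF}^-$ is a bi-interpretation. -/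

import Mathlib

open FirstOrder FirstOrder.Language FirstOrder.Language.Structure

universe u v u' v' w w'

namespace InterpSet

/-! ## The language of set theory and the theory ZF without power set -/

/-- The only symbol of the language of set theory: a binary relation symbol. -/
inductive SetRel : ℕ → Type
  | mem : SetRel 2

/-- The first-order language of set theory. -/
def setLang : FirstOrder.Language.{0, 0} := ⟨fun _ => Empty, SetRel⟩

/-- The membership symbol. -/
def memSymb : setLang.Relations 2 := SetRel.mem

/-- The membership relation `x ∈ y` of a structure in the language of set theory. -/
def Mem {M : Type*} [setLang.Structure M] (x y : M) : Prop := RelMap memSymb ![x, y]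

/-- The atomic formula `s ∈ t`. -/
def memF {α : Type*} {n : ℕ} (s t : setLang.Term (α ⊕ Fin n)) : setLang.BoundedFormula α n :=
  memSymb.boundedFormula₂ s t

/-- The universal closure of a formula whose free variables are the parameters `p₀, …, pₙ₋₁`. -/
def closure {n : ℕ} (φ : setLang.Formula (Fin n)) : setLang.Sentence :=
  BoundedFormula.alls (α := Empty) (n := n)
    (BoundedFormula.relabel (α := Fin n) (β := Empty) (n := n) (k := 0) Sum.inr φ)

/-- `∀ x y, (∀ z, z ∈ x ↔ z ∈ y) → x = y`. -/
def extensionality : setLang.Sentence :=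
  ∀' ∀' ((∀' (memF (&2) (&0) ⇔ memF (&2) (&1))) ⟹ (&0 =' &1))

/-- `∀ x, (∃ y, y ∈ x) → ∃ y, y ∈ x ∧ ∀ z, ¬ (z ∈ x ∧ z ∈ y)`. -/
def foundation : setLang.Sentence :=
  ∀' ((∃' memF (&1) (&0)) ⟹
    ∃' (memF (&1) (&0) ⊓ ∀' ∼(memF (&2) (&0) ⊓ memF (&2) (&1))))

/-- `∀ x y, ∃ z, ∀ t, t ∈ z ↔ (t = x ∨ t = y)`. -/
def pairing : setLang.Sentence :=
  ∀' ∀' ∃' ∀' (memF (&3) (&2) ⇔ ((&3 =' &0) ⊔ (&3 =' &1)))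

/-- `∀ x, ∃ y, ∀ z, z ∈ y ↔ ∃ t, t ∈ x ∧ z ∈ t`. -/
def union : setLang.Sentence :=
  ∀' ∃' ∀' (memF (&2) (&1) ⇔ ∃' (memF (&3) (&0) ⊓ memF (&2) (&3)))

/-- `∃ w, (∃ e, e ∈ w ∧ e is empty) ∧ ∀ x, x ∈ w → ∃ y, y ∈ w ∧ y = x ∪ {x}`. -/
def infinity : setLang.Sentence :=
  ∃' ((∃' (memF (&1) (&0) ⊓ ∀' ∼(memF (&2) (&1)))) ⊓
    ∀' (memF (&1) (&0) ⟹
      ∃' (memF (&2) (&0) ⊓ ∀' (memF (&3) (&2) ⇔ (memF (&3) (&1) ⊔ (&3 =' &1))))))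

/-- The instance `∀ p, ∀ a, ∃ b, ∀ x, x ∈ b ↔ (x ∈ a ∧ φ(p, x))` of the separation scheme. -/
def separation {n : ℕ} (φ : setLang.Formula (Fin n ⊕ Fin 1)) : setLang.Sentence :=
  closure (∀' ∃' ∀' (memF (&2) (&1) ⇔ (memF (&2) (&0) ⊓
    BoundedFormula.relabel (β := Fin n) (n := 3) (k := 0) (Sum.map id ![2]) φ)))

/-- The instance `∀ p, ∀ a, (∀ x ∈ a, ∃ y, φ(p, x, y)) → ∃ b, ∀ x ∈ a, ∃ y ∈ b, φ(p, x, y)`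
of the collection scheme. -/
def collection {n : ℕ} (φ : setLang.Formula (Fin n ⊕ Fin 2)) : setLang.Sentence :=
  closure (∀' ((∀' (memF (&1) (&0) ⟹
      ∃' BoundedFormula.relabel (β := Fin n) (n := 3) (k := 0) (Sum.map id ![1, 2]) φ)) ⟹
    ∃' ∀' (memF (&2) (&0) ⟹ ∃' (memF (&3) (&1) ⊓
      BoundedFormula.relabel (β := Fin n) (n := 4) (k := 0) (Sum.map id ![2, 3]) φ))))

/-- The theory `ZF⁻`: Zermelo-Fraenkel set theory without the power set axiom, formulated with
the collection scheme. -/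
def ZFminus : setLang.Theory :=
  {extensionality, foundation, pairing, union, infinity} ∪
    {σ | ∃ (n : ℕ) (φ : setLang.Formula (Fin n ⊕ Fin 1)), σ = separation φ} ∪
    {σ | ∃ (n : ℕ) (φ : setLang.Formula (Fin n ⊕ Fin 2)), σ = collection φ}

/-- A model of set theory is well-founded if its membership relation is well-founded. -/
def WellFoundedModel (M : Type*) [setLang.Structure M] : Prop :=
  WellFounded (Mem : M → M → Prop)

/-- `f` is a Mostowski collapse of `(X, ∈)` into the model `M`: for every `a`, the elements of
`f a` in `M` are exactly the values `f b` for the elements `b` of `a` in `X`. -/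
def IsMostowskiCollapse {X M : Type*} [setLang.Structure X] [setLang.Structure M]
    (f : X → M) : Prop :=
  ∀ (a : X) (y : M), Mem y (f a) ↔ ∃ b : X, Mem b a ∧ f b = y

/-! ## Interpretations -/

/-- An `n`-ary relation `S` on a class `D` of `k`-tuples of elements of `M` is definable in `M`,
with parameters allowed, as a relation of `n * k` arguments. -/
def DefinableOn (L : FirstOrder.Language.{u, v}) {M : Type w} [L.Structure M] {k : ℕ}
    {D : Set (Fin k → M)} {n : ℕ} (S : Set (Fin n → D)) : Prop :=
  (Set.univ : Set M).Definable L {x : Fin n × Fin k → M |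
    ∃ h : ∀ i, (fun l => x (i, l)) ∈ D, (fun i => ⟨fun l => x (i, l), h i⟩) ∈ S}

/-- A structure `⟨N*, R*, …⟩/≃` for the language `L` that is defined in the `L'`-structure `M`:
a definable class `N*` of `k`-tuples, a definable equivalence relation `≃` on `N*`, a definable
relation on `N*` for every relation symbol and a definable graph for every function symbol
(constants are function symbols without arguments), such that `≃` is a congruence for all of
them and the graphs are graphs of functions modulo `≃`. Definability allows parameters. -/
structure InterpretedStructure (L : FirstOrder.Language.{u, v}) (L' : FirstOrder.Language.{u', v'}) (M : Type w)
    [L'.Structure M] where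
  /-- the length of the tuples -/
  k : ℕ
  /-- the class `N*` -/
  dom : Set (Fin k → M)
  /-- the equivalence relation `≃` -/
  eqv : Setoid dom
  /-- the relations on `N*` -/
  rel : ∀ {n : ℕ}, L.Relations n → Set (Fin n → dom)
  /-- the graphs of the functions; the last entry is the value -/
  graph : ∀ {n : ℕ}, L.Functions n → Set (Fin (n + 1) → dom)
  dom_definable : (Set.univ : Set M).Definable L' dom
  eqv_definable : DefinableOn L' {x : Fin 2 → dom | eqv (x 0) (x 1)}
  rel_definable : ∀ {n : ℕ} (R : L.Relations n), DefinableOn L' (rel R)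
  graph_definable : ∀ {n : ℕ} (f : L.Functions n), DefinableOn L' (graph f)
  rel_congr : ∀ {n : ℕ} (R : L.Relations n) (x y : Fin n → dom), (∀ i, eqv (x i) (y i)) →
    (x ∈ rel R ↔ y ∈ rel R)
  graph_congr : ∀ {n : ℕ} (f : L.Functions n) (x y : Fin (n + 1) → dom),
    (∀ i, eqv (x i) (y i)) → (x ∈ graph f ↔ y ∈ graph f)
  graph_total : ∀ {n : ℕ} (f : L.Functions n) (x : Fin n → dom),
    ∃ y : dom, (Fin.snoc (α := fun _ => dom) x y) ∈ graph f
  graph_unique : ∀ {n : ℕ} (f : L.Functions n) (x : Fin n → dom) (y z : dom),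
    (Fin.snoc (α := fun _ => dom) x y) ∈ graph f →
    (Fin.snoc (α := fun _ => dom) x z) ∈ graph f → eqv y z

namespace InterpretedStructure

variable {L : FirstOrder.Language.{u, v}} {L' : FirstOrder.Language.{u', v'}} {M : Type w} [L'.Structure M]

/-- The universe `N*/≃` of the quotient structure. -/
def Carrier (D : InterpretedStructure L L' M) : Type w := Quotient D.eqv

/-- The `≃`-class of an element of `N*`. -/
def cls (D : InterpretedStructure L L' M) (x : D.dom) : D.Carrier := Quotient.mk D.eqv x

/-- The quotient structure. By the congruence conditions, the choice of representatives does
not matter; see `relMap_mk` and `funMap_mk`. -/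
noncomputable instance (D : InterpretedStructure L L' M) : L.Structure D.Carrier where
  RelMap R q := (fun i => Quotient.out (q i)) ∈ D.rel R
  funMap f q := D.cls (Classical.choose (D.graph_total f (fun i => Quotient.out (q i))))

theorem relMap_mk (D : InterpretedStructure L L' M) {n : ℕ} (R : L.Relations n)
    (x : Fin n → D.dom) : RelMap R (fun i => D.cls (x i)) ↔ x ∈ D.rel R :=
  D.rel_congr R _ _ fun i => Quotient.exact (Quotient.out_eq (D.cls (x i)))

theorem funMap_mk (D : InterpretedStructure L L' M) {n : ℕ} (f : L.Functions n)
    (x : Fin n → D.dom) (y : D.dom) :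
    funMap f (fun i => D.cls (x i)) = D.cls y ↔
      (Fin.snoc (α := fun _ => D.dom) x y) ∈ D.graph f := by
  have hs := Classical.choose_spec
    (D.graph_total f (fun i => Quotient.out (D.cls (x i))))
  have key : ∀ z : D.dom,
      (Fin.snoc (α := fun _ => D.dom) (fun i => Quotient.out (D.cls (x i))) z) ∈ D.graph f ↔
        (Fin.snoc (α := fun _ => D.dom) x z) ∈ D.graph f := by
    intro z
    refine D.graph_congr f _ _ fun i => ?_
    refine Fin.lastCases ?_ (fun j => ?_) i
    · simp
    · simpa using Quotient.exact (Quotient.out_eq (D.cls (x j)))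
  constructor
  · intro h
    have h1 := (key _).1 hs
    refine (D.graph_congr f _ _ fun i => ?_).1 h1
    refine Fin.lastCases ?_ (fun j => ?_) i
    · simpa using Quotient.exact h
    · simp
  · intro h
    exact Quotient.sound (D.graph_unique f _ _ _ hs ((key y).2 h))

/-- The graph of a map from `M` to a quotient `N*/≃` that is defined in `M`, viewed as the
relation between `a` and the members of the `≃`-class `i a`. The first argument is `a`. -/
def graphOf (D : InterpretedStructure L L' M) (i : M → D.Carrier) : Set (Unit ⊕ Fin D.k → M) :=
  {x | ∃ h : (fun l => x (Sum.inr l)) ∈ D.dom,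
    i (x (Sum.inl ())) = D.cls ⟨fun l => x (Sum.inr l), h⟩}

end InterpretedStructure

/-- An interpretation of the `L`-structure `N` in the `L'`-structure `M`: an `L`-structure
defined in `M`, together with an isomorphism of `N` with it. -/
structure Interpretation (L : FirstOrder.Language.{u, v}) (N : Type w) [L.Structure N]
    (L' : FirstOrder.Language.{u', v'}) (M : Type w') [L'.Structure M] where
  /-- the structure defined in `M` -/
  str : InterpretedStructure L L' M
  /-- the isomorphism -/
  iso : N ≃[L] str.Carrier

section Mutual

variable {L : FirstOrder.Language.{u, v}} {M : Type w} [L.Structure M]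
  {L' : FirstOrder.Language.{u', v'}} {N : Type w'} [L'.Structure N]

/-- Let `I` interpret `M` in `N` via `i : M ≅ M*/≃` and let `J` interpret `N` in `M` via
`j : N ≅ N*/≃`. The copy of `M` inside the copy `N*` of `N` consists of `I.str.k`-tuples of
`J.str.k`-tuples of elements of `M`. This is the composed isomorphism `j i` from `M` to that copy,
viewed as a relation between `a` and the tuples representing its value: `(b_l)` represents
`j i (a)` if and only if `i a` has a representative `u = (u_l)` such that, for every `l`,
`b_l` represents `j (u_l)`. -/
def compGraph (I : Interpretation L M L' N) (J : Interpretation L' N L M) :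
    Set (Unit ⊕ Fin I.str.k × Fin J.str.k → M) :=
  {x | ∃ u : I.str.dom, I.iso (x (Sum.inl ())) = I.str.cls u ∧
    ∀ l, ∃ h : (fun m => x (Sum.inr (l, m))) ∈ J.str.dom,
      J.iso (u.1 l) = J.str.cls ⟨fun m => x (Sum.inr (l, m)), h⟩}

/-- The mutual interpretation `(I, J)` of `M` and `N` is a bi-interpretation: the composed
isomorphisms of `M` and of `N` with their copies inside themselves are definable (with parameters)
in `M` and in `N` respectively. -/
def IsBiInterpretation (I : Interpretation L M L' N) (J : Interpretation L' N L M) : Prop :=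
  (Set.univ : Set M).Definable L (compGraph I J) ∧
    (Set.univ : Set N).Definable L' (compGraph J I)

end Mutual

end InterpSet

/-!
The heart of the matter is that an isomorphism `i` of a well-founded model `M` of `ZF⁻` with a copy
of itself whose membership and equality are definable in `M` is itself definable in `M`
(`RepresentedCopy.defPred_rep`). The copy is not known in advance to be set-like
in `M`, so recursion along its membership relation is problematic in `M`. Instead `i` is built by
recursion on the membership of `M`, which is set-like: `i y` is the point of the copy whose elements are the `i z`
for `z ∈ y`. An approximation (`RepresentedCopy.IsApprox`) is a set `g` of pairs `(y, b)`, coded in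
`M`, with transitive domain and satisfying this recursion equation. As `M` is really well-founded,
induction shows that approximations take only correct values (`IsApprox.rep`) and, by collection,
separation and union, that every value is taken by some approximation (`exists_isApprox`); at each
step, a value exists because `i` exists. Equivalence classes may be proper classes of `M`, which is
why approximations are multivalued: they contain at least one representative of each value.

For an interpretation of `M` in itself this gives the definability of `i`; uniqueness and the
Mostowski collapse come from extensionality and well-foundedness. For a mutual interpretation
`(I, J)` of `M` and `N`, the copy of `M` inside the copy of `N` is definable in `M` since formulas
of `N` translate along `J` to formulas of `M` (`Interpretation.defPred_pullback`), so `ji` is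
definable; exchanging `M` and `N` gives the bi-interpretation.
-/

namespace InterpSet

/-! ### Definable predicates -/

/-- A predicate on tuples of elements of `M` (indexed by a possibly infinite type) is definable
with parameters. Phrasing definability for predicates lets the lemmas below be applied by
unification along the logical structure of a predicate. -/
def DefPred (L : FirstOrder.Language.{u, v}) {M : Type w} [L.Structure M] {α : Type*}
    (P : (α → M) → Prop) : Prop :=
  (Set.univ : Set M).Definable L {x | P x}

namespace DefPred

variable {L : FirstOrder.Language.{u, v}} {M : Type w} [L.Structure M] {α β : Type*}

theorem congr {P Q : (α → M) → Prop} (hP : DefPred L P) (h : ∀ x, P x ↔ Q x) : DefPred L Q := by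
  have : P = Q := funext fun x => propext (h x)
  exact this ▸ hP

theorem and {P Q : (α → M) → Prop} (hP : DefPred L P) (hQ : DefPred L Q) :
    DefPred L fun x => P x ∧ Q x :=
  Set.Definable.inter hP hQ

theorem not {P : (α → M) → Prop} (hP : DefPred L P) : DefPred L fun x => ¬ P x :=
  Set.Definable.compl hP

theorem or {P Q : (α → M) → Prop} (hP : DefPred L P) (hQ : DefPred L Q) :
    DefPred L fun x => P x ∨ Q x :=
  Set.Definable.union hP hQ

theorem imp {P Q : (α → M) → Prop} (hP : DefPred L P) (hQ : DefPred L Q) :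
    DefPred L fun x => P x → Q x :=
  (hP.not.or hQ).congr fun _ => imp_iff_not_or.symm

theorem iff {P Q : (α → M) → Prop} (hP : DefPred L P) (hQ : DefPred L Q) :
    DefPred L fun x => (P x ↔ Q x) :=
  ((hP.imp hQ).and (hQ.imp hP)).congr fun _ => iff_iff_implies_and_implies.symm

theorem forallFinite {ι : Type*} [Finite ι] {P : ι → (α → M) → Prop}
    (hP : ∀ i, DefPred L (P i)) : DefPred L fun x => ∀ i, P i x := by
  have := Set.definable_iInter_of_finite hP
  refine DefPred.congr (P := fun x => x ∈ ⋂ i, {x | P i x}) this fun x => ?_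
  simp

theorem exTuple [Finite β] {P : (α → M) → (β → M) → Prop}
    (hP : DefPred L fun y : α ⊕ β → M => P (fun a => y (.inl a)) (fun b => y (.inr b))) :
    DefPred L fun x => ∃ z, P x z :=
  Set.Definable.exists_of_finite hP

theorem allTuple [Finite β] {P : (α → M) → (β → M) → Prop}
    (hP : DefPred L fun y : α ⊕ β → M => P (fun a => y (.inl a)) (fun b => y (.inr b))) :
    DefPred L fun x => ∀ z, P x z :=
  Set.Definable.forall_of_finite hP

theorem ex {P : (α → M) → M → Prop}
    (hP : DefPred L fun y : α ⊕ Unit → M => P (fun a => y (.inl a)) (y (.inr ()))) :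
    DefPred L fun x => ∃ z, P x z :=
  (exTuple (P := fun x (z : Unit → M) => P x (z ())) hP).congr fun _ =>
    ⟨fun ⟨z, h⟩ => ⟨z (), h⟩, fun ⟨z, h⟩ => ⟨fun _ => z, h⟩⟩

theorem all {P : (α → M) → M → Prop}
    (hP : DefPred L fun y : α ⊕ Unit → M => P (fun a => y (.inl a)) (y (.inr ()))) :
    DefPred L fun x => ∀ z, P x z :=
  (allTuple (P := fun x (z : Unit → M) => P x (z ())) hP).congr fun _ =>
    ⟨fun h z => h fun _ => z, fun h z => h (z ())⟩

/-- Renaming of variables and substitution of parameters, for arbitrarily many variables. -/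
theorem subst {P : (β → M) → Prop} (hP : DefPred L P) (f : β → M ⊕ α) :
    DefPred L fun x => P fun b => Sum.elim id x (f b) := by
  obtain ⟨φ, hφ⟩ := Set.definable_iff_exists_formula_sum.1 hP
  refine Set.definable_iff_exists_formula_sum.2
    ⟨φ.relabel (Sum.elim Sum.inl fun b => Sum.map (fun m => ⟨m, trivial⟩) id (f b)), ?_⟩
  ext x
  change (fun b => Sum.elim id x (f b)) ∈ {x | P x} ↔ _
  rw [hφ, Set.mem_ofPred_eq, Set.mem_ofPred_eq, Formula.realize_relabel]
  refine iff_of_eq (congrArg _ (funext fun c => ?_))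
  rcases c with m | b
  · rfl
  · cases hb : f b <;> simp [hb]

theorem rename {P : (β → M) → Prop} (hP : DefPred L P) (f : β → α) :
    DefPred L fun x => P fun b => x (f b) :=
  hP.subst fun b => .inr (f b)

/-- Substitution of definable functions. -/
theorem comp [Finite β] {P : (β → M) → Prop} (hP : DefPred L P) {F : β → (α → M) → M}
    (hF : ∀ b, (Set.univ : Set M).DefinableFun L (F b)) : DefPred L fun x => P fun b => F b x :=
  Set.Definable.preimage_map (F := fun x b => F b x) hF hP

theorem eq {f g : (α → M) → M} (hf : (Set.univ : Set M).DefinableFun L f)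
    (hg : (Set.univ : Set M).DefinableFun L g) : DefPred L fun x => f x = g x :=
  Set.DefinableFun.ofPred_eq hf hg

theorem rel {n : ℕ} (R : L.Relations n) : DefPred L fun x : Fin n → M => RelMap R x := by
  refine Set.Definable.mono (Set.empty_definable_iff.2 ⟨R.formula fun i => .var i, ?_⟩)
    (Set.empty_subset _)
  ext x
  simp [Formula.realize_rel]

/-- A definable predicate is given by a formula with finitely many parameters. -/
theorem exists_formula {P : (α → M) → Prop} (hP : DefPred L P) :
    ∃ (n : ℕ) (φ : L.Formula (Fin n ⊕ α)) (p : Fin n → M),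
      ∀ x, φ.Realize (Sum.elim p x) ↔ P x := by
  obtain ⟨A, -, hA⟩ := Set.definable_iff_finitely_definable.1 hP
  obtain ⟨φ, hφ⟩ := Set.definable_iff_exists_formula_sum.1 hA
  refine ⟨_, φ.relabel (Sum.map A.equivFin id), fun i => (A.equivFin.symm i : M), fun x => ?_⟩
  have h : P x ↔ x ∈ {x | P x} := Iff.rfl
  rw [h, hφ, Formula.realize_relabel]
  refine iff_of_eq (congrArg _ (funext fun c => ?_))
  rcases c with m | b
  · simp
  · rfl

end DefPred

/-- `DefinableFun` in terms of `DefPred`; the argument `.inr ()` of the graph is the value. -/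
theorem definableFun_iff {L : FirstOrder.Language.{u, v}} {M : Type w} [L.Structure M] {α : Type*}
    {f : (α → M) → M} : (Set.univ : Set M).DefinableFun L f ↔
      DefPred L fun y : α ⊕ Unit → M => y (.inr ()) = f fun a => y (.inl a) := by
  constructor
  · intro h
    refine DefPred.congr (DefPred.rename (P := fun w : Option α → M => w ∈ Function.tupleGraph f) h
      (fun o : Option α => o.elim (Sum.inr ()) Sum.inl)) fun x => ?_
    exact eq_comm
  · intro h
    refine DefPred.congr (DefPred.rename h (fun o : α ⊕ Unit => Sum.elim some (fun _ => none) o))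
      fun x => ?_
    exact eq_comm

theorem definableFun_proj (L : FirstOrder.Language.{u, v}) {M : Type w} [L.Structure M] {α : Type*}
    (a : α) : (Set.univ : Set M).DefinableFun L fun x => x a :=
  Set.DefinableFun.proj L

theorem definableFun_rename {L : FirstOrder.Language.{u, v}} {M : Type w} [L.Structure M]
    {α β : Type*} {f : (β → M) → M} (hf : (Set.univ : Set M).DefinableFun L f) (e : β → α) :
    (Set.univ : Set M).DefinableFun L fun x => f fun b => x (e b) := by
  refine definableFun_iff.2 (DefPred.congr ((definableFun_iff.1 hf).rename (Sum.map e id)) ?_)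
  exact fun x => Iff.rfl

theorem defPred_mem {M : Type w} [setLang.Structure M] {α : Type*} {f g : (α → M) → M}
    (hf : (Set.univ : Set M).DefinableFun setLang f)
    (hg : (Set.univ : Set M).DefinableFun setLang g) :
    DefPred setLang fun x => Mem (f x) (g x) := by
  refine (DefPred.comp (DefPred.rel memSymb) (F := ![f, g]) ?_).congr fun x => ?_
  · intro b
    fin_cases b
    · exact hf
    · exact hg
  · unfold Mem
    refine iff_of_eq (congrArg _ (funext fun b => ?_))
    fin_cases b <;> rfl

/-! ### Consequences of `ZF⁻` -/

section Axioms

variable {M : Type w} [setLang.Structure M]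

theorem realize_memF {α : Type*} {n : ℕ} {s t : setLang.Term (α ⊕ Fin n)} {x : α → M}
    {y : Fin n → M} :
    (memF s t).Realize x y ↔ Mem (s.realize (Sum.elim x y)) (t.realize (Sum.elim x y)) :=
  BoundedFormula.realize_rel₂

theorem realize_closure {n : ℕ} {φ : setLang.Formula (Fin n)} :
    M ⊨ closure φ ↔ ∀ p : Fin n → M, φ.Realize p := by
  refine BoundedFormula.realize_alls.trans (forall_congr' fun p => ?_)
  exact Formula.realize_relabel_sumInr φ

theorem ZFminus.ext (hM : M ⊨ ZFminus) {x y : M} (h : ∀ z, Mem z x ↔ Mem z y) : x = y := by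
  have := hM.realize_of_mem extensionality (by simp [ZFminus])
  simp [Sentence.Realize, extensionality, Formula.Realize, realize_memF, Fin.snoc] at this
  exact this x y h

theorem ZFminus.exists_pair (hM : M ⊨ ZFminus) (x y : M) :
    ∃ z : M, ∀ t, Mem t z ↔ t = x ∨ t = y := by
  have := hM.realize_of_mem pairing (by simp [ZFminus])
  simp [Sentence.Realize, pairing, Formula.Realize, realize_memF, Fin.snoc] at this
  exact this x y

theorem ZFminus.exists_union (hM : M ⊨ ZFminus) (x : M) :
    ∃ y : M, ∀ z, Mem z y ↔ ∃ t, Mem t x ∧ Mem z t := by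
  have := hM.realize_of_mem union (by simp [ZFminus])
  simp [Sentence.Realize, union, Formula.Realize, realize_memF, Fin.snoc] at this
  exact this x

/-- The shape in which the matrix of an instance of separation or collection appears after its
quantifiers are unfolded. -/
theorem realize_comp_map {α : Type*} {n k : ℕ} (φ : setLang.Formula (α ⊕ Fin k)) (p : α → M)
    (x : Fin n → M) (f : Fin k → Fin n) (z : Fin 0 → M) :
    BoundedFormula.Realize φ (Sum.elim p x ∘ Sum.map id f) z ↔
      φ.Realize (Sum.elim p (x ∘ f)) := by
  rw [Formula.Realize, Subsingleton.elim z default, Sum.elim_comp_map, Function.comp_id]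

theorem ZFminus.exists_sep (hM : M ⊨ ZFminus) {P : M → Prop}
    (hP : DefPred setLang fun x : Fin 1 → M => P (x 0)) (a : M) :
    ∃ b : M, ∀ x, Mem x b ↔ Mem x a ∧ P x := by
  obtain ⟨n, φ, p, hφ⟩ := hP.exists_formula
  have := hM.realize_of_mem (separation φ) (Or.inl (Or.inr ⟨n, φ, rfl⟩))
  have := realize_closure.1 this p
  simp only [Formula.Realize, BoundedFormula.realize_all, BoundedFormula.realize_ex,
    BoundedFormula.realize_iff, BoundedFormula.realize_inf, realize_memF,
    BoundedFormula.realize_relabel, Fin.castAdd_zero, Fin.cast_refl, Function.comp_id] at this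
  simp only [realize_comp_map, hφ] at this
  exact this a

theorem ZFminus.exists_collection (hM : M ⊨ ZFminus) {P : M → M → Prop}
    (hP : DefPred setLang fun x : Fin 2 → M => P (x 0) (x 1)) (a : M)
    (h : ∀ x, Mem x a → ∃ y, P x y) :
    ∃ b : M, ∀ x, Mem x a → ∃ y, Mem y b ∧ P x y := by
  obtain ⟨n, φ, p, hφ⟩ := hP.exists_formula
  have := hM.realize_of_mem (collection φ) (Or.inr ⟨n, φ, rfl⟩)
  have := realize_closure.1 this p
  simp only [Formula.Realize, BoundedFormula.realize_all, BoundedFormula.realize_ex,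
    BoundedFormula.realize_imp, BoundedFormula.realize_inf, realize_memF,
    BoundedFormula.realize_relabel, Fin.castAdd_zero, Fin.cast_refl, Function.comp_id] at this
  simp only [realize_comp_map, hφ] at this
  exact this a h

/-- The unordered pair `{x, y}` in `M`. -/
noncomputable def pair (hM : M ⊨ ZFminus) (x y : M) : M := (ZFminus.exists_pair hM x y).choose

theorem mem_pair (hM : M ⊨ ZFminus) {x y t : M} : Mem t (pair hM x y) ↔ t = x ∨ t = y :=
  (ZFminus.exists_pair hM x y).choose_spec t

theorem definableFun_pair (hM : M ⊨ ZFminus) {α : Type*} {f g : (α → M) → M}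
    (hf : (Set.univ : Set M).DefinableFun setLang f)
    (hg : (Set.univ : Set M).DefinableFun setLang g) :
    (Set.univ : Set M).DefinableFun setLang fun x => pair hM (f x) (g x) := by
  refine definableFun_iff.2 (DefPred.congr (P := fun y => ∀ t, Mem t (y (.inr ())) ↔
    t = f (fun a => y (.inl a)) ∨ t = g fun a => y (.inl a)) ?_ fun x => ?_)
  · exact .all <| .iff (defPred_mem (definableFun_proj _ _) (definableFun_proj _ _)) <|
      .or (.eq (definableFun_proj _ _) (definableFun_rename (definableFun_rename hf _) _))
        (.eq (definableFun_proj _ _) (definableFun_rename (definableFun_rename hg _) _))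
  · refine ⟨fun h => ZFminus.ext hM fun t => (h t).trans (mem_pair hM).symm, fun h t => ?_⟩
    rw [h]
    exact mem_pair hM

/-- The Kuratowski pair `{{x}, {x, y}}` in `M`. -/
noncomputable def opair (hM : M ⊨ ZFminus) (x y : M) : M := pair hM (pair hM x x) (pair hM x y)

theorem pair_inj_right (hM : M ⊨ ZFminus) {x y z : M} (h : pair hM x y = pair hM x z) : y = z := by
  have h1 : y = x ∨ y = z := (mem_pair hM).1 (h ▸ (mem_pair hM).2 (Or.inr rfl))
  have h2 : z = x ∨ z = y := (mem_pair hM).1 (h.symm ▸ (mem_pair hM).2 (Or.inr rfl))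
  grind

theorem opair_inj (hM : M ⊨ ZFminus) {x y x' y' : M} (h : opair hM x y = opair hM x' y') :
    x = x' ∧ y = y' := by
  have hx : x = x' := by
    have h1 : Mem (pair hM x x) (opair hM x' y') := h ▸ (mem_pair hM).2 (Or.inl rfl)
    have h2 : Mem x' (pair hM x x) := by
      rcases (mem_pair hM).1 h1 with h1 | h1 <;> rw [h1] <;> exact (mem_pair hM).2 (Or.inl rfl)
    exact ((mem_pair hM).1 h2).elim Eq.symm Eq.symm
  subst hx
  exact ⟨rfl, pair_inj_right hM (pair_inj_right hM h)⟩

/-- The iterated ordered pair `(b k₁, (b k₂, … (b kₙ, y)))` in `M`, for `ks = [k₁, …, kₙ]`. -/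
noncomputable def code (hM : M ⊨ ZFminus) {κ : Type*} (ks : List κ) (y : M) (b : κ → M) : M :=
  ks.foldr (fun k z => opair hM (b k) z) y

theorem code_inj (hM : M ⊨ ZFminus) {κ : Type*} {ks : List κ} (hks : ∀ k, k ∈ ks) {y y' : M}
    {b b' : κ → M} (h : code hM ks y b = code hM ks y' b') : y = y' ∧ b = b' := by
  have key : ∀ l : List κ, code hM l y b = code hM l y' b' → y = y' ∧ ∀ k ∈ l, b k = b' k := by
    intro l
    induction l with
    | nil => exact fun h => ⟨h, by simp⟩
    | cons k l ih =>
      intro h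
      obtain ⟨h1, h2⟩ := opair_inj hM h
      exact ⟨(ih h2).1, List.forall_mem_cons.2 ⟨h1, (ih h2).2⟩⟩
  exact ⟨(key ks h).1, funext fun k => (key ks h).2 k (hks k)⟩

theorem definableFun_code (hM : M ⊨ ZFminus) {κ α : Type*} (ks : List κ) {f : (α → M) → M}
    {g : κ → (α → M) → M} (hf : (Set.univ : Set M).DefinableFun setLang f)
    (hg : ∀ k, (Set.univ : Set M).DefinableFun setLang (g k)) :
    (Set.univ : Set M).DefinableFun setLang fun x => code hM ks (f x) fun k => g k x := by
  induction ks with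
  | nil => exact hf
  | cons k ks ih =>
    exact definableFun_pair hM (definableFun_pair hM (hg k) (hg k)) (definableFun_pair hM (hg k) ih)

end Axioms

/-! ### Definability of isomorphisms with interpreted copies -/

/-- A copy of `⟨M, ∈⟩` on classes of `κ`-tuples of elements of `M`, given together with a possibly
undefinable isomorphism: `R y b` says that the tuple `b` represents the image of `y`. The relations
`E` and `Eqv` are the membership and the equality of the copy; the tuples `b` with `Eqv b b` are
those that represent something. -/
structure RepresentedCopy (M : Type w) [setLang.Structure M] (κ : Type*) where
  /-- the tuple `b` represents the image of `y` -/
  R : M → (κ → M) → Prop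
  /-- the membership relation of the copy -/
  E : (κ → M) → (κ → M) → Prop
  /-- the equality relation of the copy -/
  Eqv : (κ → M) → (κ → M) → Prop
  exists_rep : ∀ y, ∃ b, R y b
  rep_unique : ∀ {x y b}, R x b → R y b → x = y
  E_iff : ∀ {b c}, E b c ↔ ∃ x y, R x b ∧ R y c ∧ Mem x y
  Eqv_iff : ∀ {b c}, Eqv b c ↔ ∃ x, R x b ∧ R x c

namespace RepresentedCopy

variable {M : Type w} [setLang.Structure M] {κ : Type*} (C : RepresentedCopy M κ)
  (hM : M ⊨ ZFminus) (ks : List κ)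

/-- The set `g` of codes of pairs `(y, b)` is an approximation of the isomorphism: its domain is
transitive, and for every `(y, b)` in it, `b` is a tuple of the copy whose elements in the copy are
exactly the values of `g` at the elements of `y`. This does not mention the isomorphism itself. -/
def IsApprox (g : M) : Prop :=
  ∀ y b, Mem (code hM ks y b) g → C.Eqv b b ∧ (∀ z, Mem z y → ∃ c, Mem (code hM ks z c) g) ∧
    ∀ c, C.Eqv c c → (C.E c b ↔ ∃ z, Mem z y ∧ ∃ c', Mem (code hM ks z c') g ∧ C.Eqv c' c)

variable {C} {hM} {ks}

/-- An approximation agrees with the isomorphism. By induction on `y`: the tuple `b` represents some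
`y'`, and `y'` and `y` have the same elements. -/
theorem IsApprox.rep (hwf : WellFoundedModel M) {g : M} (hg : C.IsApprox hM ks g) {y : M} :
    ∀ {b}, Mem (code hM ks y b) g → C.R y b := by
  induction y using hwf.induction with
  | _ y ih =>
  intro b hb
  obtain ⟨hbb, hdom, hel⟩ := hg y b hb
  obtain ⟨y', hy', -⟩ := C.Eqv_iff.1 hbb
  suffices y' = y from this ▸ hy'
  refine ZFminus.ext hM fun z => ⟨fun hz => ?_, fun hz => ?_⟩
  · obtain ⟨c, hc⟩ := C.exists_rep z
    obtain ⟨z', hz', c', hc', he⟩ :=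
      (hel c (C.Eqv_iff.2 ⟨z, hc, hc⟩)).1 (C.E_iff.2 ⟨z, y', hc, hy', hz⟩)
    obtain ⟨w, hw', hw⟩ := C.Eqv_iff.1 he
    rw [C.rep_unique hc hw, C.rep_unique hw' (ih z' hz' hc')]
    exact hz'
  · obtain ⟨c, hc⟩ := hdom z hz
    have hzc := ih z hz hc
    have hcc := C.Eqv_iff.2 ⟨z, hzc, hzc⟩
    obtain ⟨x, y'', hx, hy'', hxy⟩ := C.E_iff.1 ((hel c hcc).2 ⟨z, hz, c, hc, hcc⟩)
    rwa [C.rep_unique hzc hx, C.rep_unique hy' hy'']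

/-- A set of values of the isomorphism whose domain is transitive is an approximation. -/
theorem IsApprox.of_rep {g : M}
    (h : ∀ y b, Mem (code hM ks y b) g →
      C.R y b ∧ ∀ z, Mem z y → ∃ c, Mem (code hM ks z c) g ∧ C.R z c) :
    C.IsApprox hM ks g := by
  intro y b hb
  obtain ⟨hyb, hdom⟩ := h y b hb
  refine ⟨C.Eqv_iff.2 ⟨y, hyb, hyb⟩, fun z hz => (hdom z hz).imp fun c hc => hc.1, fun c _ => ?_⟩
  constructor
  · intro hcb
    obtain ⟨x, y', hx, hy', hxy⟩ := C.E_iff.1 hcb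
    rw [C.rep_unique hy' hyb] at hxy
    obtain ⟨c', hc', hxc'⟩ := hdom x hxy
    exact ⟨x, hxy, c', hc', C.Eqv_iff.2 ⟨x, hxc', hx⟩⟩
  · rintro ⟨z, hz, c', hc', he⟩
    obtain ⟨w, hw', hw⟩ := C.Eqv_iff.1 he
    rw [C.rep_unique hw' (h z c' hc').1] at hw
    exact C.E_iff.2 ⟨z, y, hw, hyb, hz⟩

variable (hM) (ks) in
theorem defPred_isApprox [Finite κ]
    (hE : DefPred setLang fun x : κ ⊕ κ → M => C.E (fun k => x (.inl k)) fun k => x (.inr k))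
    (hEqv : DefPred setLang fun x : κ ⊕ κ → M => C.Eqv (fun k => x (.inl k)) fun k => x (.inr k))
    {α : Type*} (a : α) : DefPred setLang fun x : α → M => C.IsApprox hM ks (x a) := by
  have hcode : ∀ {β : Type _} (i : β) (j : κ → β) (a : β),
      DefPred setLang fun x : β → M => Mem (code hM ks (x i) fun k => x (j k)) (x a) :=
    fun i j a => defPred_mem (definableFun_code hM ks (definableFun_proj _ i)
      fun k => definableFun_proj _ (j k)) (definableFun_proj _ a)
  have hmem : ∀ {β : Type _} (i j : β), DefPred setLang fun x : β → M => Mem (x i) (x j) :=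
    fun i j => defPred_mem (definableFun_proj _ i) (definableFun_proj _ j)
  unfold IsApprox
  refine .all <| .allTuple <| .imp (hcode _ _ _) <| .and ?_ <| .and ?_ ?_
  · exact hEqv.rename (Sum.elim _ _)
  · exact .all <| .imp (hmem _ _) <| .exTuple (hcode _ _ _)
  · refine .allTuple <| .imp ?_ <| .iff ?_ <| .ex <| .and (hmem _ _) <| .exTuple <|
      .and (hcode _ _ _) ?_
    · exact hEqv.rename (Sum.elim _ _)
    · exact hE.rename (Sum.elim _ _)
    · exact hEqv.rename (Sum.elim _ _)

/-- Every value of the isomorphism belongs to an approximation, by induction along the external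
well-founded membership relation of `M`. -/
theorem exists_isApprox (hwf : WellFoundedModel M) (hks : ∀ k, k ∈ ks) [Finite κ]
    (hE : DefPred setLang fun x : κ ⊕ κ → M => C.E (fun k => x (.inl k)) fun k => x (.inr k))
    (hEqv : DefPred setLang fun x : κ ⊕ κ → M => C.Eqv (fun k => x (.inl k)) fun k => x (.inr k))
    {y : M} : ∀ {b}, C.R y b → ∃ g, C.IsApprox hM ks g ∧ Mem (code hM ks y b) g := by
  induction y using hwf.induction with
  | _ y ih =>
  intro b hb
  -- collect approximations that are defined at the elements of `y`
  obtain ⟨B, hB⟩ := ZFminus.exists_collection hM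
    (P := fun z g => C.IsApprox hM ks g ∧ ∃ c, Mem (code hM ks z c) g)
    (.and (defPred_isApprox hM ks hE hEqv _) (.exTuple (defPred_mem
      (definableFun_code hM ks (definableFun_proj _ _) fun k => definableFun_proj _ _)
      (definableFun_proj _ _)))) y (fun z hz => by
        obtain ⟨c, hc⟩ := C.exists_rep z
        obtain ⟨g, hg, hgc⟩ := ih z hz hc
        exact ⟨g, hg, c, hgc⟩)
  obtain ⟨B', hB'⟩ := ZFminus.exists_sep hM (P := fun g => C.IsApprox hM ks g)
    (defPred_isApprox hM ks hE hEqv _) B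
  obtain ⟨U, hU⟩ := ZFminus.exists_union hM B'
  -- add the pair `(y, b)` to their union
  obtain ⟨V, hV⟩ := ZFminus.exists_union hM
    (pair hM U (pair hM (code hM ks y b) (code hM ks y b)))
  have hV' : ∀ t, Mem t V ↔ (∃ g, C.IsApprox hM ks g ∧ Mem g B ∧ Mem t g) ∨
      t = code hM ks y b := by
    intro t
    simp only [hV, mem_pair, or_and_right, exists_or, exists_eq_left, hU, hB',
      or_self]
    grind
  refine ⟨V, IsApprox.of_rep fun y' b' h => ?_, (hV' _).2 (Or.inr rfl)⟩
  rcases (hV' _).1 h with ⟨g, hg, hgB, hm⟩ | heq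
  · refine ⟨hg.rep hwf hm, fun z hz => ?_⟩
    obtain ⟨c, hc⟩ := (hg y' b' hm).2.1 z hz
    exact ⟨c, (hV' _).2 (Or.inl ⟨g, hg, hgB, hc⟩), hg.rep hwf hc⟩
  · obtain ⟨rfl, rfl⟩ := code_inj hM hks heq
    refine ⟨hb, fun z hz => ?_⟩
    obtain ⟨g, hgB, hg, c, hc⟩ := hB z hz
    exact ⟨c, (hV' _).2 (Or.inl ⟨g, hg, hgB, hc⟩), hg.rep hwf hc⟩

variable (C) in
/-- If the membership and the equality of a copy of `M` are definable, then so is the isomorphism: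
it is the union of all approximations. -/
theorem defPred_rep [Finite κ] (hM : M ⊨ ZFminus) (hwf : WellFoundedModel M)
    (hE : DefPred setLang fun x : κ ⊕ κ → M => C.E (fun k => x (.inl k)) fun k => x (.inr k))
    (hEqv : DefPred setLang fun x : κ ⊕ κ → M => C.Eqv (fun k => x (.inl k)) fun k => x (.inr k)) :
    DefPred setLang fun x : Unit ⊕ κ → M => C.R (x (.inl ())) fun k => x (.inr k) := by
  obtain ⟨ks, hks⟩ : ∃ ks : List κ, ∀ k, k ∈ ks := by
    cases nonempty_fintype κ
    exact ⟨Finset.univ.toList, by simp⟩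
  refine DefPred.congr (P := fun x => ∃ g, C.IsApprox hM ks g ∧
    Mem (code hM ks (x (.inl ())) fun k => x (.inr k)) g) ?_ fun x => ?_
  · exact .ex <| .and (defPred_isApprox hM ks hE hEqv _) (defPred_mem
      (definableFun_code hM ks (definableFun_proj _ _) fun k => definableFun_proj _ _)
      (definableFun_proj _ _))
  · exact ⟨fun ⟨g, hg, h⟩ => hg.rep hwf h, fun h => exists_isApprox hwf hks hE hEqv h⟩

end RepresentedCopy

/-! ### Translation of definable predicates along an interpretation -/

namespace Interpretation

variable {L : FirstOrder.Language.{u, v}} {N : Type w} [L.Structure N]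
  {L' : FirstOrder.Language.{u', v'}} {M : Type w'} [L'.Structure M] (J : Interpretation L N L' M)

/-- The tuple `b` represents the image of `n` in the interpreted copy of `N`. -/
def Rep (n : N) (b : Fin J.str.k → M) : Prop :=
  ∃ h : b ∈ J.str.dom, J.iso n = J.str.cls ⟨b, h⟩

theorem exists_rep (n : N) : ∃ b, J.Rep n b := by
  obtain ⟨b, hb⟩ := Quotient.exists_rep (J.iso n)
  exact ⟨b.1, b.2, hb.symm⟩

variable {J}

theorem Rep.unique {n n' : N} {b : Fin J.str.k → M} (h : J.Rep n b) (h' : J.Rep n' b) :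
    n = n' := by
  obtain ⟨_, h⟩ := h
  obtain ⟨_, h'⟩ := h'
  exact J.iso.injective (h.trans h'.symm)

theorem exists_rep_iff {b : Fin J.str.k → M} : (∃ n, J.Rep n b) ↔ b ∈ J.str.dom := by
  refine ⟨fun ⟨_, h, _⟩ => h, fun h => ⟨J.iso.symm (J.str.cls ⟨b, h⟩), h, by simp⟩⟩

theorem Rep.eqv_iff {n : N} {b c : Fin J.str.k → M} (h : J.Rep n b) :
    J.Rep n c ↔ ∃ h : ∀ i : Fin 2, ![b, c] i ∈ J.str.dom,
      J.str.eqv ⟨![b, c] 0, h 0⟩ ⟨![b, c] 1, h 1⟩ := by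
  obtain ⟨hb, hn⟩ := h
  constructor
  · rintro ⟨hc, hc'⟩
    exact ⟨by simp [Fin.forall_fin_two, hb, hc], Quotient.exact (hn.symm.trans hc')⟩
  · rintro ⟨h, he⟩
    exact ⟨h 1, hn.trans (Quotient.sound he)⟩

theorem relMap_iff {n : ℕ} (R : L.Relations n) {v : Fin n → N} {x : Fin n × Fin J.str.k → M}
    (h : ∀ i, J.Rep (v i) fun l => x (i, l)) : RelMap R v ↔
      ∃ h : ∀ i, (fun l => x (i, l)) ∈ J.str.dom,
        (fun i => ⟨fun l => x (i, l), h i⟩) ∈ J.str.rel R := by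
  choose hd hv using h
  rw [← J.iso.map_rel, exists_prop_of_true hd, ← J.str.relMap_mk]
  exact iff_of_eq (congrArg _ (funext hv))

theorem rep_funMap_iff {n : ℕ} (f : L.Functions n) {v : Fin n → N}
    {x : Fin (n + 1) × Fin J.str.k → M} (h : ∀ i : Fin n, J.Rep (v i) fun l => x (i.castSucc, l)) :
    J.Rep (funMap f v) (fun l => x (Fin.last n, l)) ↔
      ∃ h : ∀ i, (fun l => x (i, l)) ∈ J.str.dom,
        (fun i => ⟨fun l => x (i, l), h i⟩) ∈ J.str.graph f := by
  choose hd hv using h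
  have key : ∀ h : ∀ i, (fun l => x (i, l)) ∈ J.str.dom,
      J.iso (funMap f v) = J.str.cls ⟨fun l => x (Fin.last n, l), h _⟩ ↔
        (fun i => ⟨fun l => x (i, l), h i⟩) ∈ J.str.graph f := by
    intro h
    rw [J.iso.map_fun, show J.iso ∘ v = fun i => J.str.cls ⟨_, hd i⟩ from funext hv,
      J.str.funMap_mk]
    refine iff_of_eq (congrArg (· ∈ J.str.graph f) (funext fun i => ?_))
    refine Fin.lastCases ?_ (fun j => ?_) i <;> simp
  constructor
  · rintro ⟨hl, he⟩
    have h : ∀ i, (fun l => x (i, l)) ∈ J.str.dom := fun i => Fin.lastCases hl hd i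
    exact ⟨h, (key h).1 he⟩
  · rintro ⟨h, hg⟩
    exact ⟨_, (key h).2 hg⟩

variable (J)

/-- The graph of a term of `L` translates to a definable predicate of `M`. Nothing is claimed when
some `x (a, ·)` represents no element of `N`, so that `α` may be infinite. -/
theorem exists_translation_term {α : Type*} (t : L.Term α) :
    ∃ T : (α × Fin J.str.k → M) → (Fin J.str.k → M) → Prop,
      (DefPred L' fun x : (α × Fin J.str.k) ⊕ Fin J.str.k → M =>
        T (fun a => x (.inl a)) fun l => x (.inr l)) ∧
      ∀ x v, (∀ a, J.Rep (v a) fun l => x (a, l)) → ∀ y, T x y ↔ J.Rep (t.realize v) y := by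
  induction t with
  | var a =>
    refine ⟨fun x y => ∃ h : ∀ i : Fin 2, ![fun l => x (a, l), y] i ∈ J.str.dom,
      J.str.eqv ⟨![fun l => x (a, l), y] 0, h 0⟩ ⟨![fun l => x (a, l), y] 1, h 1⟩,
      ?_, fun x v h y => (h a).eqv_iff.symm⟩
    refine DefPred.congr (DefPred.rename J.str.eqv_definable
      fun p : Fin 2 × Fin J.str.k => ![Sum.inl (a, p.2), Sum.inr p.2] p.1) fun x => ?_
    refine exists_prop_congr (fun _ => Iff.rfl) (forall_congr' fun i => ?_)
    fin_cases i <;> rfl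
  | @func n f ts ih =>
    choose T hT hT' using ih
    refine ⟨fun x y => ∃ z : Fin (n + 1) × Fin J.str.k → M,
      ((∀ l, y l = z (Fin.last n, l)) ∧ ∀ i : Fin n, T i x fun l => z (i.castSucc, l)) ∧
      ∃ h : ∀ i, (fun l => z (i, l)) ∈ J.str.dom,
        (fun i => ⟨fun l => z (i, l), h i⟩) ∈ J.str.graph f, ?_, fun x v h y => ?_⟩
    · refine .exTuple <| .and (.and ?_ ?_) ?_
      · exact .forallFinite fun l => .eq (definableFun_proj _ _) (definableFun_proj _ _)
      · exact .forallFinite fun i => (hT i).rename (Sum.elim _ _)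
      · exact DefPred.rename (J.str.graph_definable f) _
    · constructor
      · rintro ⟨z, ⟨hy, hz⟩, hg⟩
        obtain rfl : y = fun l => z (Fin.last n, l) := funext hy
        exact (rep_funMap_iff f fun i => (hT' i x v h _).1 (hz i)).2 hg
      · intro hy
        choose z hz using fun i => J.exists_rep ((ts i).realize v)
        let z' : Fin (n + 1) × Fin J.str.k → M :=
          fun p => Fin.snoc (α := fun _ => Fin J.str.k → M) z y p.1 p.2
        have hz' : ∀ i : Fin n, (fun l => z' (i.castSucc, l)) = z i := fun i => by simp [z']
        have hy' : (fun l => z' (Fin.last n, l)) = y := by simp [z']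
        refine ⟨z', ⟨fun l => (congrFun hy' l).symm, fun i => ?_⟩, ?_⟩
        · rw [hz']
          exact (hT' i x v h _).2 (hz i)
        · refine (rep_funMap_iff f (v := fun i => (ts i).realize v) fun i => ?_).1 ?_
          · rw [hz']
            exact hz i
          · rw [hy']
            exact hy

/-- An `L`-formula translates to a definable predicate of `M`: quantifiers are relativized to the
domain of the interpretation, and atomic formulas are translated by the interpreted relations. -/
theorem exists_translation_boundedFormula {α : Type*} {n : ℕ} (φ : L.BoundedFormula α n) :
    ∃ Q : ((α ⊕ Fin n) × Fin J.str.k → M) → Prop, DefPred L' Q ∧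
      ∀ x (v : α ⊕ Fin n → N), (∀ a, J.Rep (v a) fun l => x (a, l)) →
        (Q x ↔ φ.Realize (fun a => v (.inl a)) fun i => v (.inr i)) := by
  have hv : ∀ {n : ℕ} (v : α ⊕ Fin n → N),
      (Sum.elim (fun a => v (.inl a)) fun i => v (.inr i)) = v := fun v => by
    ext a; cases a <;> rfl
  induction φ with
  | falsum =>
    exact ⟨fun _ => False, Set.definable_empty, fun _ _ _ => Iff.rfl⟩
  | equal t₁ t₂ =>
    obtain ⟨T₁, hT₁, hT₁'⟩ := J.exists_translation_term t₁
    obtain ⟨T₂, hT₂, hT₂'⟩ := J.exists_translation_term t₂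
    refine ⟨fun x => ∃ y, T₁ x y ∧ T₂ x y, .exTuple (hT₁.and hT₂), fun x v h => ?_⟩
    simp only [hT₁' x v h, hT₂' x v h, BoundedFormula.Realize, hv]
    refine ⟨fun ⟨y, h₁, h₂⟩ => h₁.unique h₂, fun h => ?_⟩
    obtain ⟨y, hy⟩ := J.exists_rep (t₁.realize v)
    exact ⟨y, hy, h ▸ hy⟩
  | @rel _ m R ts =>
    choose T hT hT' using fun i => J.exists_translation_term (ts i)
    refine ⟨fun x => ∃ z : Fin m × Fin J.str.k → M, (∀ i, T i x fun l => z (i, l)) ∧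
      ∃ h : ∀ i, (fun l => z (i, l)) ∈ J.str.dom,
        (fun i => ⟨fun l => z (i, l), h i⟩) ∈ J.str.rel R, ?_, fun x v h => ?_⟩
    · refine .exTuple <| .and (.forallFinite fun i => ?_) ?_
      · exact (hT i).rename (Sum.elim _ _)
      · exact DefPred.rename (J.str.rel_definable R) _
    · simp only [BoundedFormula.Realize, hv]
      constructor
      · rintro ⟨z, hz, hR⟩
        exact (relMap_iff R fun i => (hT' i x v h _).1 (hz i)).2 hR
      · intro hR
        choose z hz using fun i => J.exists_rep ((ts i).realize v)
        exact ⟨fun p => z p.1 p.2, fun i => (hT' i x v h _).2 (hz i),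
          (relMap_iff R (x := fun p => z p.1 p.2) hz).1 hR⟩
  | imp φ₁ φ₂ ih₁ ih₂ =>
    obtain ⟨Q₁, hQ₁, hQ₁'⟩ := ih₁
    obtain ⟨Q₂, hQ₂, hQ₂'⟩ := ih₂
    exact ⟨fun x => Q₁ x → Q₂ x, hQ₁.imp hQ₂,
      fun x v h => imp_congr (hQ₁' x v h) (hQ₂' x v h)⟩
  | @all n φ ih =>
    obtain ⟨Q, hQ, hQ'⟩ := ih
    -- the variables of `φ`, as the variables of `∀' φ` and a last one
    let e : (α ⊕ Fin (n + 1)) → (α ⊕ Fin n) ⊕ Unit :=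
      Sum.elim (fun a => .inl (.inl a)) (Fin.lastCases (.inr ()) fun i => .inl (.inr i))
    let f : (α ⊕ Fin (n + 1)) × Fin J.str.k → ((α ⊕ Fin n) × Fin J.str.k) ⊕ Fin J.str.k :=
      fun p => Sum.map (fun a => (a, p.2)) (fun _ => p.2) (e p.1)
    refine ⟨fun x => ∀ y, y ∈ J.str.dom → Q fun p => Sum.elim x y (f p), ?_, fun x v h => ?_⟩
    · refine .allTuple <| .imp (DefPred.rename J.str.dom_definable _) ?_
      refine DefPred.congr (hQ.rename f) fun x => ?_
      refine iff_of_eq (congrArg Q (funext fun p => ?_))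
      cases f p <;> rfl
    · have key : ∀ y m, J.Rep m y → ((Q fun p => Sum.elim x y (f p)) ↔
          φ.Realize (fun a => v (.inl a)) (Fin.snoc (fun i => v (.inr i)) m)) := by
        intro y m hm
        refine (hQ' _ (fun a => Sum.elim v (fun _ => m) (e a)) fun a => ?_).trans ?_
        · simp only [f]
          cases e a with
          | inl a => exact h a
          | inr a => exact hm
        · refine iff_of_eq (congrArg _ (funext fun i => ?_))
          refine Fin.lastCases ?_ (fun j => ?_) i <;> simp [e]
      refine ⟨fun H m => ?_, fun H y hy => ?_⟩
      · obtain ⟨y, hy⟩ := J.exists_rep m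
        exact (key y m hy).1 (H y hy.1)
      · obtain ⟨m, hm⟩ := exists_rep_iff.2 hy
        exact (key y m hm).2 (H m)

/-- Equality of the represented elements is definable: it is the equivalence relation of `J`. -/
theorem defPred_rep_eq :
    DefPred L' fun x : Fin J.str.k ⊕ Fin J.str.k → M =>
      ∃ a, J.Rep a (fun l => x (.inl l)) ∧ J.Rep a fun l => x (.inr l) := by
  refine DefPred.congr (DefPred.rename J.str.eqv_definable
    fun p : Fin 2 × Fin J.str.k => ![Sum.inl p.2, Sum.inr p.2] p.1) fun x => ?_
  constructor
  · rintro ⟨h, he⟩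
    obtain ⟨a, ha⟩ := exists_rep_iff.2 (h 0)
    exact ⟨a, ha, h 1, (show J.iso a = _ from ha.2).trans (Quotient.sound he)⟩
  · rintro ⟨a, ⟨h₀, e₀⟩, h₁, e₁⟩
    exact ⟨Fin.forall_fin_two.2 ⟨h₀, h₁⟩, Quotient.exact (e₀.symm.trans e₁)⟩

/-- The preimage of a definable predicate of `N` under `(b_a) ↦ (j⁻¹[b_a])` is definable in `M`. -/
theorem defPred_pullback {α : Type*} [Finite α] {P : (α → N) → Prop} (hP : DefPred L P) :
    DefPred L' fun x : α × Fin J.str.k → M =>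
      ∃ v : α → N, (∀ a, J.Rep (v a) fun l => x (a, l)) ∧ P v := by
  obtain ⟨n, φ, p, hφ⟩ := hP.exists_formula
  obtain ⟨Q, hQ, hQ'⟩ := J.exists_translation_boundedFormula φ
  choose c hc using fun i => J.exists_rep (p i)
  let f : ((Fin n ⊕ α) ⊕ Fin 0) × Fin J.str.k → M ⊕ (α × Fin J.str.k) := fun q =>
    Sum.elim (Sum.elim (fun i => .inl (c i q.2)) fun a => .inr (a, q.2)) Fin.elim0 q.1
  refine DefPred.congr (P := fun x => (∀ a, (fun l => x (a, l)) ∈ J.str.dom) ∧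
    Q fun q => Sum.elim id x (f q)) (.and (.forallFinite fun a => ?_) (hQ.subst f)) fun x => ?_
  · exact DefPred.rename J.str.dom_definable _
  · have key : ∀ v : α → N, (∀ a, J.Rep (v a) fun l => x (a, l)) →
        ((Q fun q => Sum.elim id x (f q)) ↔ P v) := by
      intro v hv
      rw [← hφ, Formula.Realize]
      refine (hQ' _ (Sum.elim (Sum.elim p v) Fin.elim0) ?_).trans ?_
      · rintro ((i | a) | i)
        · exact hc i
        · exact hv a
        · exact i.elim0
      · exact iff_of_eq (congrArg _ (Subsingleton.elim _ _))
    constructor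
    · rintro ⟨hd, hq⟩
      choose v hv using fun a => exists_rep_iff.2 (hd a)
      exact ⟨v, hv, (key v hv).1 hq⟩
    · rintro ⟨v, hv, hp⟩
      exact ⟨fun a => (hv a).1, (key v hv).2 hp⟩

end Interpretation

/-! ### Self-interpretations and mutual interpretations -/

section

variable {L : FirstOrder.Language.{u, v}} {N : Type w} [L.Structure N] {M : Type w'}
  [setLang.Structure M]

theorem mem_map_iff {X Y : Type*} [setLang.Structure X] [setLang.Structure Y] (i : X ≃[setLang] Y)
    {x y : X} : Mem (i x) (i y) ↔ Mem x y := by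
  refine Iff.trans (iff_of_eq (congrArg (RelMap memSymb) (funext fun b => ?_)))
    (i.map_rel memSymb ![x, y])
  fin_cases b <;> rfl

namespace Interpretation

/-- Membership between represented elements of `M` is definable in the interpreting structure. -/
theorem defPred_rep_mem (I : Interpretation setLang M L N) :
    DefPred L fun x : Fin I.str.k ⊕ Fin I.str.k → N =>
      ∃ a b, I.Rep a (fun l => x (.inl l)) ∧ I.Rep b (fun l => x (.inr l)) ∧ Mem a b := by
  refine DefPred.congr (DefPred.rename (I.str.rel_definable memSymb)
    fun p : Fin 2 × Fin I.str.k => ![Sum.inl p.2, Sum.inr p.2] p.1) fun x => ?_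
  have key : ∀ a b, I.Rep a (fun l => x (.inl l)) → I.Rep b (fun l => x (.inr l)) → (Mem a b ↔ _) :=
    fun a b ha hb => relMap_iff memSymb (v := ![a, b])
      (x := fun p : Fin 2 × Fin I.str.k => x (![Sum.inl p.2, Sum.inr p.2] p.1))
      (Fin.forall_fin_two.2 ⟨ha, hb⟩)
  constructor
  · rintro ⟨h, hR⟩
    obtain ⟨a, ha⟩ := exists_rep_iff.2 (h 0)
    obtain ⟨b, hb⟩ := exists_rep_iff.2 (h 1)
    exact ⟨a, b, ha, hb, (key a b ha hb).2 ⟨h, hR⟩⟩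
  · rintro ⟨a, b, ha, hb, hab⟩
    exact (key a b ha hb).1 hab

/-- The copy of `M` given by an interpretation of `M` in itself. -/
def representedCopy (I : Interpretation setLang M setLang M) :
    RepresentedCopy M (Fin I.str.k) where
  R := I.Rep
  E b c := ∃ x y, I.Rep x b ∧ I.Rep y c ∧ Mem x y
  Eqv b c := ∃ x, I.Rep x b ∧ I.Rep x c
  exists_rep := I.exists_rep
  rep_unique := Rep.unique
  E_iff := Iff.rfl
  Eqv_iff := Iff.rfl

theorem definable_graphOf (hM : M ⊨ ZFminus) (hwf : WellFoundedModel M)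
    (I : Interpretation setLang M setLang M) :
    (Set.univ : Set M).Definable setLang (I.str.graphOf I.iso) :=
  I.representedCopy.defPred_rep hM hwf I.defPred_rep_mem I.defPred_rep_eq

/-- The tuple of tuples `b` represents the image of `a` under the composition of the
interpretations `I` and `J`. -/
def CompRep (I : Interpretation setLang M L N) (J : Interpretation L N setLang M) (a : M)
    (b : Fin I.str.k × Fin J.str.k → M) : Prop :=
  ∃ u, I.Rep a u ∧ ∀ l, J.Rep (u l) fun m => b (l, m)

/-- The copy of `M` inside the copy of `N` in `M`, for a mutual interpretation of `M` and `N`. -/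
def compRepresentedCopy (I : Interpretation setLang M L N) (J : Interpretation L N setLang M) :
    RepresentedCopy M (Fin I.str.k × Fin J.str.k) where
  R := I.CompRep J
  E b c := ∃ x y, I.CompRep J x b ∧ I.CompRep J y c ∧ Mem x y
  Eqv b c := ∃ x, I.CompRep J x b ∧ I.CompRep J x c
  exists_rep a := by
    obtain ⟨u, hu⟩ := I.exists_rep a
    choose b hb using fun l => J.exists_rep (u l)
    exact ⟨fun p => b p.1 p.2, u, hu, hb⟩
  rep_unique := by
    rintro x y b ⟨u, hu, hub⟩ ⟨v, hv, hvb⟩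
    obtain rfl : u = v := funext fun l => (hub l).unique (hvb l)
    exact hu.unique hv
  E_iff := Iff.rfl
  Eqv_iff := Iff.rfl

theorem definable_compGraph (hM : M ⊨ ZFminus) (hwf : WellFoundedModel M)
    (I : Interpretation setLang M L N) (J : Interpretation L N setLang M) :
    (Set.univ : Set M).Definable setLang (compGraph I J) := by
  -- both relations of the copy are pullbacks along `J` of relations definable in `N`
  let f : (Fin I.str.k ⊕ Fin I.str.k) × Fin J.str.k →
      (Fin I.str.k × Fin J.str.k) ⊕ (Fin I.str.k × Fin J.str.k) :=
    fun p => Sum.map (fun l => (l, p.2)) (fun l => (l, p.2)) p.1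
  have h := (I.compRepresentedCopy J).defPred_rep hM hwf
    (((J.defPred_pullback I.defPred_rep_mem).rename f).congr fun x => ?_)
    (((J.defPred_pullback I.defPred_rep_eq).rename f).congr fun x => ?_)
  · refine DefPred.congr h fun x => ?_
    constructor
    · rintro ⟨u, ⟨hu, e⟩, h⟩
      exact ⟨⟨u, hu⟩, e, h⟩
    · rintro ⟨u, e, h⟩
      exact ⟨u.1, ⟨u.2, e⟩, h⟩
  · constructor
    · rintro ⟨v, hv, a, b, ha, hb, hab⟩
      exact ⟨a, b, ⟨_, ha, fun l => hv (.inl l)⟩, ⟨_, hb, fun l => hv (.inr l)⟩, hab⟩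
    · rintro ⟨a, b, ⟨u, ha, hu⟩, ⟨u', hb, hu'⟩, hab⟩
      exact ⟨Sum.elim u u', Sum.forall.2 ⟨hu, hu'⟩, a, b, ha, hb, hab⟩
  · constructor
    · rintro ⟨v, hv, a, ha, hb⟩
      exact ⟨a, ⟨_, ha, fun l => hv (.inl l)⟩, ⟨_, hb, fun l => hv (.inr l)⟩⟩
    · rintro ⟨a, ⟨u, ha, hu⟩, ⟨u', hb, hu'⟩⟩
      exact ⟨Sum.elim u u', Sum.forall.2 ⟨hu, hu'⟩, a, ha, hb⟩

end Interpretation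

variable {X : Type*} [setLang.Structure X]

theorem isMostowskiCollapse_symm (i : M ≃[setLang] X) : IsMostowskiCollapse i.symm := by
  intro a y
  rw [← mem_map_iff i, i.apply_symm_apply]
  refine ⟨fun h => ⟨i y, h, i.symm_apply_apply y⟩, ?_⟩
  rintro ⟨b, hb, rfl⟩
  rwa [i.apply_symm_apply]

/-- A well-founded structure has at most one Mostowski collapse, by extensionality of `M`. -/
theorem IsMostowskiCollapse.eq (hM : M ⊨ ZFminus) (hX : WellFounded (Mem : X → X → Prop))
    {f g : X → M} (hf : IsMostowskiCollapse f) (hg : IsMostowskiCollapse g) : f = g := by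
  funext a
  induction a using hX.induction with
  | _ a ih =>
  refine ZFminus.ext hM fun y => ?_
  rw [hf, hg]
  exact exists_congr fun b => and_congr_right fun hb => by rw [ih b hb]

theorem wellFounded_mem_of_equiv (hwf : WellFoundedModel M) (i : M ≃[setLang] X) :
    WellFounded (Mem : X → X → Prop) :=
  Subrelation.wf (fun {_ _} h => (mem_map_iff i.symm).2 h) (InvImage.wf i.symm hwf)

end

end InterpSet

theorem mainTheorem8 {M : Type w} [InterpSet.setLang.Structure M]
    (hM : M ⊨ InterpSet.ZFminus) (hwf : InterpSet.WellFoundedModel M) :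
    -- every interpretation of `M` in itself: the isomorphism `i` is the only one, it is definable
    -- in `M`, and its inverse is the Mostowski collapse of the interpreted structure
    (∀ (D : InterpSet.InterpretedStructure InterpSet.setLang InterpSet.setLang M)
        (i : M ≃[InterpSet.setLang] D.Carrier),
      (∀ i' : M ≃[InterpSet.setLang] D.Carrier, i' = i) ∧
      (Set.univ : Set M).Definable InterpSet.setLang (D.graphOf i) ∧
      WellFounded (InterpSet.Mem : D.Carrier → D.Carrier → Prop) ∧
      (∀ f : D.Carrier → M, InterpSet.IsMostowskiCollapse f ↔ f = i.symm)) ∧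
    -- mutual interpretation with an arbitrary structure `N` in an arbitrary language
    (∀ (L : FirstOrder.Language.{u, v}) (N : Type w') [L.Structure N]
        (I : InterpSet.Interpretation InterpSet.setLang M L N)
        (J : InterpSet.Interpretation L N InterpSet.setLang M),
      (Set.univ : Set M).Definable InterpSet.setLang (InterpSet.compGraph I J)) ∧
    -- mutual interpretation with another well-founded model of `ZF⁻`
    (∀ (N : Type w') [InterpSet.setLang.Structure N],
      N ⊨ InterpSet.ZFminus → InterpSet.WellFoundedModel N →
      ∀ (I : InterpSet.Interpretation InterpSet.setLang M InterpSet.setLang N)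
        (J : InterpSet.Interpretation InterpSet.setLang N InterpSet.setLang M),
      InterpSet.IsBiInterpretation I J) := by
  refine ⟨fun D i => ?_, fun L N _ I J => I.definable_compGraph hM hwf J,
    fun N _ hN hNwf I J => ⟨I.definable_compGraph hM hwf J, J.definable_compGraph hN hNwf I⟩⟩
  have hD := InterpSet.wellFounded_mem_of_equiv hwf i
  have hcol : ∀ f : D.Carrier → M, InterpSet.IsMostowskiCollapse f ↔ f = i.symm := fun f =>
    ⟨fun h => h.eq hM hD (InterpSet.isMostowskiCollapse_symm i),
      fun h => h ▸ InterpSet.isMostowskiCollapse_symm i⟩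
  refine ⟨fun i' => ?_, InterpSet.Interpretation.definable_graphOf hM hwf ⟨D, i⟩, hD, hcol⟩
  -- the inverses of both isomorphisms are Mostowski collapses, hence equal
  have h : ⇑i'.symm = i.symm := (hcol _).1 (InterpSet.isMostowskiCollapse_symm i')
  ext a
  rw [← i.symm.injective.eq_iff, ← h, i'.symm_apply_apply, h, i.symm_apply_apply]
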